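/- Let $Q\ge 1$ be an integer and $K>1$ a real number. Let $\mathbf{Q}_Q(\mathbb{R})$ be the set of unordered $Q$-tuples $\sum_{i=1}^Q[[p_i]]$ of real numbers, with the metric $\mathcal{G}\big(\sum_i[[p_i]],\sum_i[[q_i]]\big)=\min_\sigma\big(\sum_i|p_i-q_{\sigma(i)}|^2\big)^{1/2}$ over all permutations $\sigma$, and let $\xi:\mathbf{Q}_Q(\mathbb{R})\to\mathbb{R}^Q$ send a tuple to its nondecreasing rearrangement. For an open interval $U\subset\mathbb{R}$ (possibly $U=\mathbb{R}$), $\mathcal{Y}_2(U,\mathbf{Q}_Q(\mathbb{R}))$ is the set of $u:U\to\mathbf{Q}_Q(\mathbb{R})$ with $\xi\circ u\in W^{1,2}(U,\mathbb{R}^Q)$, maps that agree a.e. being identified; $u$ is strictly defined if $\xi(u(x))=y$ whenever $x\in U$, $y\in\mathbb{R}^Q$ and $r^{-1}\int_{x-r}^{x+r}|\xi(u(z))-y|\,dz\to0$ as $r\to 0^+$. If there are affine functions $v_1,\dots,v_Q:\mathbb{R}\to\mathbb{R}$ such that $\mathcal{G}\big(u(z),\sum_i[[v_i(z)]]\big)/|z-x|$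 has approximate limit $0$ as $z\to x$, put $|\mathrm{ap}Au(x)|^2=\sum_i|v_i'|^2$; for $u\in\mathcal{Y}_2(U,\mathbf{Q}_Q(\mathbb{R}))$ this is the case for a.e. $x\in U$, and $\mathrm{Dir}(u,U)=\int_U|\mathrm{ap}Au(x)|^2\,dx$. For a bounded open interval $U$ and $g:\partial U\to\mathbf{Q}_Q(\mathbb{R})$, a map $u$ has boundary values $g$ on $\partial U$ if there is a strictly defined $w\in\mathcal{Y}_2(\mathbb{R},\mathbf{Q}_Q(\mathbb{R}))$ with $w=u$ a.e. on $U$ and $w=g$ on $\partial U$. A map $v\in\mathcal{Y}_2(U,\mathbf{Q}_Q(\mathbb{R}))$ with boundary values $g$ is Dirichlet minimizing if $\mathrm{Dir}(v,U)$ is the infimum of $\mathrm{Dir}(w,U)$ over all $w\in\mathcal{Y}_2(U,\mathbf{Q}_Q(\mathbb{R}))$ with boundary values $g$. A strictly defined $u\in\mathcal{Y}_2((-1,1),\mathbf{Q}_Q(\mathbb{R}))$ is a Dirichlet $K$-quasiminimizer if for every interval $(a,b)$ with $-1\le a<b\le 1$ one has $\mathrm{Dir}(u,(a,b))\le K\,\mathrm{Dir}(v,(a,b))$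 whenever $v$ is Dirichlet minimizing on $(a,b)$ with the boundary values of $u$ on $\partial(a,b)$. **Theorem.** Let $u\in\mathcal{Y}_2((-1,1),\mathbf{Q}_Q(\mathbb{R}))$ be strictly defined. The following are equivalent: 1. $u$ is a Dirichlet $K$-quasiminimizer; 2. for all $-1<a<b<1$, $$\mathrm{Dir}(u,(a,b))\le K\,\frac{\mathcal{G}^2(u(b),u(a))}{b-a};$$ 3. for all $-1\le a<b\le 1$, $u$ has boundary values $g$ on $\partial(a,b)$, for some $g:\{a,b\}\to\mathbf{Q}_Q(\mathbb{R})$ with $$\mathrm{Dir}(u,(a,b))\le K\,\frac{\mathcal{G}^2(g(b),g(a))}{b-a}.$$ -/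

import Mathlib

open Set Filter Topology MeasureTheory
open scoped ENNReal ContDiff

noncomputable section

namespace MultiValued

/-- The point `∑ i, [[p i]]` of `𝐐_Q(ℝ)`. The space `𝐐_Q(ℝ)` of unordered `Q`-tuples of reals
(sums of `Q` Dirac masses) is `Sym ℝ Q`, the type of multisets of cardinality `Q`. -/
def ofTuple {Q : ℕ} (p : Fin Q → ℝ) : Sym ℝ Q :=
  ⟨Finset.univ.val.map p, by simp⟩

/-- The nondecreasing enumeration `p₁ ≤ ⋯ ≤ p_Q` of `∑ i, [[p i]]`. -/
def sorted {Q : ℕ} (s : Sym ℝ Q) (i : Fin Q) : ℝ :=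
  (s.1.sort (· ≤ ·)).get (i.cast (by rw [Multiset.length_sort, s.2]))

theorem ofTuple_sorted {Q : ℕ} (s : Sym ℝ Q) : ofTuple (sorted s) = s := by
  have hlen : (s.1.sort (· ≤ ·)).length = Q := by rw [Multiset.length_sort, s.2]
  apply Subtype.ext
  have h : List.ofFn (sorted s) = s.1.sort (· ≤ ·) := by
    apply List.ext_get
    · rw [hlen, List.length_ofFn]
    · intro n h1 h2
      simp only [sorted, List.get_ofFn]
      rfl
  have h2 : (Finset.univ.val.map (sorted s) : Multiset ℝ) = (List.ofFn (sorted s) : Multiset ℝ) := by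
    rw [Fin.univ_val_map]
  change (Finset.univ.val.map (sorted s) : Multiset ℝ) = s.1
  rw [h2, h, Multiset.sort_eq]

/-- The metric `𝒢(s, t) = min_σ (∑ i, |s_i - t_{σ i}|²)^{1/2}`, `σ` running through all permutations.
By `dist𝒢_ofTuple` the enumerations used do not matter. -/
def dist𝒢 {Q : ℕ} (s t : Sym ℝ Q) : ℝ :=
  Finset.univ.inf' Finset.univ_nonempty
    fun σ : Equiv.Perm (Fin Q) => √(∑ i, |sorted s i - sorted t (σ i)| ^ 2)

theorem exists_perm_of_ofTuple_eq {Q : ℕ} {p q : Fin Q → ℝ} (h : ofTuple p = ofTuple q) :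
    ∃ π : Equiv.Perm (Fin Q), ∀ i, p i = q (π i) := by
  have h1 : (List.ofFn p : Multiset ℝ) = (List.ofFn q : Multiset ℝ) := by
    rw [← Fin.univ_val_map, ← Fin.univ_val_map]
    exact congrArg Subtype.val h
  have h2 : p ∘ Tuple.sort p = q ∘ Tuple.sort q := List.ofFn_injective <|
    ((((Tuple.sort p).ofFn_comp_perm p).trans (Multiset.coe_eq_coe.1 h1)).trans
      ((Tuple.sort q).ofFn_comp_perm q).symm).eq_of_pairwise' (r := (· ≤ ·))
      (Tuple.monotone_sort p).sortedLE_ofFn.pairwise (Tuple.monotone_sort q).sortedLE_ofFn.pairwise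
  refine ⟨(Tuple.sort p).symm.trans (Tuple.sort q), fun i => ?_⟩
  simpa using congrFun h2 ((Tuple.sort p).symm i)

theorem dist𝒢_ofTuple {Q : ℕ} (p q : Fin Q → ℝ) :
    dist𝒢 (ofTuple p) (ofTuple q) = Finset.univ.inf' Finset.univ_nonempty
      fun σ : Equiv.Perm (Fin Q) => √(∑ i, |p i - q (σ i)| ^ 2) := by
  obtain ⟨α, hα⟩ := exists_perm_of_ofTuple_eq (ofTuple_sorted (ofTuple p))
  obtain ⟨β, hβ⟩ := exists_perm_of_ofTuple_eq (ofTuple_sorted (ofTuple q))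
  have key : ∀ σ : Equiv.Perm (Fin Q),
      √(∑ i, |sorted (ofTuple p) i - sorted (ofTuple q) (σ i)| ^ 2) =
        √(∑ i, |p i - q ((α.symm.trans (σ.trans β)) i)| ^ 2) := by
    intro σ
    congr 1
    rw [← Equiv.sum_comp α (fun i => |p i - q ((α.symm.trans (σ.trans β)) i)| ^ 2)]
    simp [hα, hβ]
  apply le_antisymm
  · refine Finset.le_inf' _ _ fun σ _ => ?_
    refine (Finset.inf'_le _ (Finset.mem_univ (α.trans (σ.trans β.symm)))).trans (le_of_eq ?_)
    rw [key]
    simp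
  · refine Finset.le_inf' _ _ fun σ _ => ?_
    rw [key]
    exact Finset.inf'_le _ (Finset.mem_univ _)

/-- The bi-Lipschitz embedding `ξ : 𝐐_Q(ℝ) → ℝ^Q`; for real-valued tuples it is the sorting map
(one projection direction, `P = 1`). -/
def ξ {Q : ℕ} (s : Sym ℝ Q) : EuclideanSpace ℝ (Fin Q) :=
  WithLp.toLp 2 (sorted s)

/-! ### Sobolev spaces -/

/-- `g` is the distributional derivative of `f` on the open set `U ⊆ ℝ`. -/
def IsWeakDeriv {E : Type*} [NormedAddCommGroup E] [NormedSpace ℝ E]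
    (U : Set ℝ) (f g : ℝ → E) : Prop :=
  ∀ φ : ℝ → ℝ, ContDiff ℝ ∞ φ → HasCompactSupport φ → tsupport φ ⊆ U →
    ∫ x in U, deriv φ x • f x = -∫ x in U, φ x • g x

/-- `f ∈ W^{1,2}(U, E)`. Only the values of `f` on `U` matter. -/
def MemW12 {E : Type*} [NormedAddCommGroup E] [NormedSpace ℝ E]
    (U : Set ℝ) (f : ℝ → E) : Prop :=
  MemLp f 2 (volume.restrict U) ∧
    ∃ g : ℝ → E, MemLp g 2 (volume.restrict U) ∧ IsWeakDeriv U f g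

/-- `f` is strictly defined on the open set `U`: `f x = y` whenever `x ∈ U` and
`r⁻¹ ∫_{B(x,r)} |f - y| → 0` as `r → 0`. -/
def IsStrictlyDefined {E : Type*} [NormedAddCommGroup E] (U : Set ℝ) (f : ℝ → E) : Prop :=
  ∀ x ∈ U, ∀ y : E,
    Tendsto (fun r : ℝ => (∫⁻ z in Metric.closedBall x r, ‖f z - y‖ₑ) / ENNReal.ofReal r)
      (𝓝[>] 0) (𝓝 0) → f x = y

/-- `u ∈ 𝒴₂(U, 𝐐_Q(ℝ))`, for `U` an open interval or `ℝ`. Only the values of `u` on `U` matter. -/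
def MemY2 {Q : ℕ} (U : Set ℝ) (u : ℝ → Sym ℝ Q) : Prop :=
  MemW12 U fun x => ξ (u x)

/-- `u` is strictly defined on `U`. -/
def StrictlyDefined {Q : ℕ} (U : Set ℝ) (u : ℝ → Sym ℝ Q) : Prop :=
  IsStrictlyDefined U fun x => ξ (u x)

/-! ### Approximate affine approximation and the Dirichlet integral -/

/-- `ap lim_{x → a} f x = l`: for every `ε > 0` the set where `|f - l| ≥ ε` has density `0`
at `a`. -/
def HasApLim (f : ℝ → ℝ) (a l : ℝ) : Prop :=
  ∀ ε > 0, Tendsto (fun r : ℝ => volume (Metric.closedBall a r ∩ {x | ε ≤ |f x - l|}) /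
    volume (Metric.closedBall a r)) (𝓝[>] 0) (𝓝 0)

/-- `u` is approximately affinely approximable at `a`, by `∑ i, [[v i]]` with affine `v i`. -/
def HasApAffine {Q : ℕ} (u : ℝ → Sym ℝ Q) (a : ℝ) (v : Fin Q → (ℝ →ᵃ[ℝ] ℝ)) : Prop :=
  HasApLim (fun x => dist𝒢 (u x) (ofTuple fun i => v i x) / |x - a|) a 0

open Classical in
/-- `|ap A u(a)|² = ∑ i, |v_i'|²`, where `ap A u(a) = ∑ i, [[v i]]`. The value `0` at points where
`u` is not approximately affinely approximable is immaterial: for `u ∈ 𝒴₂` these form a null set. -/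
def apNormSq {Q : ℕ} (u : ℝ → Sym ℝ Q) (a : ℝ) : ℝ≥0∞ :=
  if h : ∃ v, HasApAffine u a v then ENNReal.ofReal (∑ i, |(h.choose i).linear 1| ^ 2) else 0

/-- The Dirichlet integral `Dir(u; U) = ∫_U |ap A u|²`. -/
def Dir {Q : ℕ} (u : ℝ → Sym ℝ Q) (U : Set ℝ) : ℝ≥0∞ :=
  ∫⁻ x in U, apNormSq u x

/-! ### Boundary values, minimizers and quasiminimizers -/

/-- `u` has boundary values `g` on `∂U`: some strictly defined `w ∈ 𝒴₂(ℝ, 𝐐_Q(ℝ))` agrees with `u`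
in `𝒴₂(U, 𝐐_Q(ℝ))` (almost everywhere on `U`) and with `g` on `∂U`
(`ℋ⁰`-almost everywhere, that is, everywhere). Only the values of `g` on `∂U` matter. -/
def HasBoundaryValues {Q : ℕ} (U : Set ℝ) (u g : ℝ → Sym ℝ Q) : Prop :=
  ∃ w : ℝ → Sym ℝ Q, MemY2 univ w ∧ StrictlyDefined univ w ∧
    (∀ᵐ x ∂volume.restrict U, w x = u x) ∧ ∀ x ∈ frontier U, w x = g x

/-- `v` is Dirichlet minimizing on `U` with boundary values `g`. -/
def IsDirMinimizing {Q : ℕ} (U : Set ℝ) (g v : ℝ → Sym ℝ Q) : Prop :=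
  MemY2 U v ∧ HasBoundaryValues U v g ∧
    Dir v U = sInf {d | ∃ w : ℝ → Sym ℝ Q, MemY2 U w ∧ HasBoundaryValues U w g ∧ d = Dir w U}

/-- `u` is a Dirichlet `K`-quasiminimizer on `(-1, 1)`. The balls of `ℝ` contained in `(-1, 1)` are
the intervals `(a, b)` with `-1 ≤ a < b ≤ 1`; `g` stands for `u|_{∂(a, b)}`. -/
def IsQuasiminimizer {Q : ℕ} (K : ℝ) (u : ℝ → Sym ℝ Q) : Prop :=
  MemY2 (Ioo (-1) 1) u ∧ StrictlyDefined (Ioo (-1) 1) u ∧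
    ∀ a b : ℝ, -1 ≤ a → a < b → b ≤ 1 →
      ∀ g v : ℝ → Sym ℝ Q, HasBoundaryValues (Ioo a b) u g → IsDirMinimizing (Ioo a b) g v →
        Dir u (Ioo a b) ≤ ENNReal.ofReal K * Dir v (Ioo a b)

end MultiValued

end

/-!
Sorting identifies `𝐐_Q(ℝ)` isometrically with the closed convex cone of nondecreasing vectors of
`ℝ^Q`: by the rearrangement inequality the identity permutation is an optimal matching of two sorted
tuples. A `W^{1,2}` map on an interval is a primitive of an `L²` function `g`, so a strictly defined
`u` is continuous, and at almost every point differentiability of `ξ ∘ u` gives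
`|ap A u|² = ‖g‖²`. By the Cauchy–Schwarz inequality, the energy on `(a, b)` of a map with boundary
values `h` is at least `𝒢(h b, h a)² / (b - a)`; the linear interpolation of `ξ (h a)` and `ξ (h b)`
stays in the cone and attains this bound. Quasiminimality therefore compares `Dir u (a, b)` with
`K * 𝒢(u b, u a)² / (b - a)`, and both quantities are continuous in the endpoints up to `±1`.
-/

noncomputable section

namespace MultiValued

section Primitive

theorem intervalIntegrable_of_locallyIntegrable {E : Type*} [NormedAddCommGroup E] {g : ℝ → E}
    (hg : LocallyIntegrable g) (x y : ℝ) : IntervalIntegrable g volume x y :=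
  intervalIntegrable_iff.mpr <|
    (hg.integrableOn_isCompact isCompact_uIcc).mono_set uIoc_subset_uIcc

variable {E : Type*} [NormedAddCommGroup E] [NormedSpace ℝ E] {F g : ℝ → E} {U : Set ℝ}
  {a b : ℝ}

/-- `F` is a primitive (an indefinite integral) of the locally integrable function `g` on `ℝ`. The
primitives of square integrable functions are the continuous representatives of one-dimensional
Sobolev functions. -/
structure IsPrimitive (F g : ℝ → E) : Prop where
  locallyIntegrable : LocallyIntegrable g
  sub_eq_integral : ∀ x y, F y - F x = ∫ t in x..y, g t

theorem isPrimitive_integral (hg : LocallyIntegrable g) (c : E) (a : ℝ) :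
    IsPrimitive (fun x => c + ∫ t in a..x, g t) g := by
  refine ⟨hg, fun x y => ?_⟩
  rw [add_sub_add_left_eq_sub, intervalIntegral.integral_interval_sub_left] <;>
    exact intervalIntegrable_of_locallyIntegrable hg _ _

namespace IsPrimitive

theorem intervalIntegrable (hF : IsPrimitive F g) (x y : ℝ) : IntervalIntegrable g volume x y :=
  intervalIntegrable_of_locallyIntegrable hF.locallyIntegrable x y

theorem eq_add (hF : IsPrimitive F g) (a : ℝ) : F = fun x => F a + ∫ t in a..x, g t := by
  funext x
  rw [← hF.sub_eq_integral a x, add_sub_cancel]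

theorem continuous (hF : IsPrimitive F g) : Continuous F := by
  rw [hF.eq_add 0]
  exact continuous_const.add
    (intervalIntegral.continuous_primitive hF.intervalIntegrable 0)

theorem ae_hasDerivAt [CompleteSpace E] (hF : IsPrimitive F g) :
    ∀ᵐ x, HasDerivAt F (g x) x := by
  filter_upwards [LocallyIntegrable.ae_hasDerivAt_integral hF.locallyIntegrable] with x hx
  rw [hF.eq_add 0]
  exact (hx 0).const_add _

theorem dist_le_dist_integral_norm (hF : IsPrimitive F g) (a x y : ℝ) :
    dist (F x) (F y) ≤ dist (∫ t in a..x, ‖g t‖) (∫ t in a..y, ‖g t‖) := by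
  have hi := fun x y => (hF.intervalIntegrable x y).norm
  rw [dist_comm, dist_comm (∫ t in a..x, ‖g t‖), dist_eq_norm, Real.dist_eq, hF.sub_eq_integral,
    intervalIntegral.integral_interval_sub_left (hi a y) (hi a x)]
  exact intervalIntegral.norm_integral_le_abs_integral_norm

theorem absolutelyContinuousOnInterval (hF : IsPrimitive F g) (a b : ℝ) :
    AbsolutelyContinuousOnInterval F a b := by
  have hnorm := (hF.intervalIntegrable a b).norm.absolutelyContinuousOnInterval_intervalIntegral
    left_mem_uIcc
  exact squeeze_zero (fun _ => Finset.sum_nonneg fun _ _ => dist_nonneg)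
    (fun _ => Finset.sum_le_sum fun _ _ => hF.dist_le_dist_integral_norm a _ _) hnorm

end IsPrimitive

theorem isPrimitive_of_ae_hasDerivAt [CompleteSpace E]
    (hF : ∀ a b, AbsolutelyContinuousOnInterval F a b) (hg : LocallyIntegrable g)
    (hFg : ∀ᵐ x, HasDerivAt F (g x) x) : IsPrimitive F g := by
  refine ⟨hg, fun x y => ?_⟩
  have hG := isPrimitive_integral hg 0 x
  obtain ⟨c, hc⟩ := ((hF x y).sub
    (hG.absolutelyContinuousOnInterval x y)).const_of_ae_hasDerivAt_zero <| by
      filter_upwards [hFg, hG.ae_hasDerivAt] with t hFt hGt _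
      simpa only [sub_self] using hFt.sub hGt
  have hxy := (hc y right_mem_uIcc).trans (hc x left_mem_uIcc).symm
  simp only [Pi.sub_apply, zero_add, intervalIntegral.integral_same, sub_zero] at hxy
  rw [← hxy, sub_sub_cancel]

namespace IsPrimitive

theorem smul [CompleteSpace E] (hF : IsPrimitive F g) {χ : ℝ → ℝ} (hχ : ContDiff ℝ 1 χ) :
    IsPrimitive (fun x => χ x • F x) fun x => χ x • g x + deriv χ x • F x := by
  refine isPrimitive_of_ae_hasDerivAt
    (fun a b => hχ.contDiffOn.absolutelyContinuousOnInterval.smul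
      (hF.absolutelyContinuousOnInterval a b)) ?_ ?_
  · exact (hF.locallyIntegrable.continuous_smul hχ.continuous).add
      ((hχ.continuous_deriv le_rfl).smul hF.continuous).locallyIntegrable
  · filter_upwards [hF.ae_hasDerivAt] with x hx
    exact (hχ.differentiable one_ne_zero x).hasDerivAt.smul hx

theorem integral_eq_zero (hF : IsPrimitive F g) (hc : HasCompactSupport F)
    (hg : Integrable g) : ∫ x, g x = 0 := by
  rw [hasCompactSupport_iff_eventuallyEq, coclosedCompact_eq_cocompact,
    cocompact_eq_atBot_atTop] at hc
  have htop : Tendsto F atTop (𝓝 0) :=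
    tendsto_const_nhds.congr' (hc.filter_mono le_sup_right).symm
  have hbot : Tendsto F atBot (𝓝 0) :=
    tendsto_const_nhds.congr' (hc.filter_mono le_sup_left).symm
  have hlim := intervalIntegral_tendsto_integral hg tendsto_neg_atTop_atBot tendsto_id
  simp only [← hF.sub_eq_integral] at hlim
  simpa using tendsto_nhds_unique hlim (htop.sub (hbot.comp tendsto_neg_atTop_atBot))

theorem clamp (hF : IsPrimitive F g) (hab : a ≤ b) :
    IsPrimitive (fun x => F (max a (min b x))) ((Ioc a b).indicator g) := by
  refine ⟨hF.locallyIntegrable.indicator measurableSet_Ioc, fun x y => ?_⟩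
  wlog hxy : x ≤ y generalizing x y
  · rw [intervalIntegral.integral_symm, ← this y x (le_of_not_ge hxy), neg_sub]
  have hIoc : Ioc x y ∩ Ioc a b = Ioc (max a (min b x)) (max a (min b y)) := by
    ext t
    simp only [mem_inter_iff, mem_Ioc]
    grind
  rw [hF.sub_eq_integral, intervalIntegral.integral_of_le (by gcongr),
    intervalIntegral.integral_of_le hxy, setIntegral_indicator measurableSet_Ioc, hIoc]

end IsPrimitive

theorem setIntegral_smul_of_tsupport_subset {φ : ℝ → ℝ} (hφ : tsupport φ ⊆ U) (f : ℝ → E) :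
    ∫ x in U, φ x • f x = ∫ x, φ x • f x :=
  setIntegral_eq_integral_of_forall_compl_eq_zero fun x hx => by
    rw [image_eq_zero_of_notMem_tsupport fun h => hx (hφ h), zero_smul]

theorem IsPrimitive.isWeakDeriv [CompleteSpace E] (hF : IsPrimitive F g) (U : Set ℝ) :
    IsWeakDeriv U F g := by
  intro φ hφ hc hU
  have hφF : Integrable fun x => deriv φ x • F x :=
    ((hφ.continuous_deriv (by simp)).smul hF.continuous).integrable_of_hasCompactSupport
      hc.deriv.smul_right
  have hφg : Integrable fun x => φ x • g x :=
    hF.locallyIntegrable.integrable_smul_left_of_hasCompactSupport hφ.continuous hc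
  have hsum := (hF.smul (hφ.of_le (by simp))).integral_eq_zero hc.smul_right (hφg.add hφF)
  rw [integral_add hφg hφF] at hsum
  rw [setIntegral_smul_of_tsupport_subset hU,
    setIntegral_smul_of_tsupport_subset (tsupport_deriv_subset.trans hU)]
  exact eq_neg_of_add_eq_zero_right hsum

theorem integrable_smul_of_tsupport_subset {f : ℝ → E} (hf : LocallyIntegrableOn f U)
    {φ : ℝ → ℝ} (hφ : Continuous φ) (hc : HasCompactSupport φ) (hU : tsupport φ ⊆ U) :
    Integrable fun x => φ x • f x := by
  have hsupp : Function.support (fun x => φ x • f x) ⊆ tsupport φ :=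
    (Function.support_smul_subset_left _ _).trans (subset_tsupport φ)
  rw [← integrableOn_iff_integrable_of_support_subset hsupp]
  exact (hf.integrableOn_compact_subset hU hc).continuousOn_smul hφ.continuousOn hc

theorem IsWeakDeriv.congr_ae {f f' g' : ℝ → E} (h : IsWeakDeriv U f g)
    (hf : f =ᵐ[volume.restrict U] f') (hg : g =ᵐ[volume.restrict U] g') :
    IsWeakDeriv U f' g' := by
  intro φ hφ hc hU
  have hφf : (fun x => deriv φ x • f x) =ᵐ[volume.restrict U] fun x => deriv φ x • f' x := by
    filter_upwards [hf] with x hx using by rw [hx]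
  have hφg : (fun x => φ x • g x) =ᵐ[volume.restrict U] fun x => φ x • g' x := by
    filter_upwards [hg] with x hx using by rw [hx]
  rw [← integral_congr_ae hφf, ← integral_congr_ae hφg, h φ hφ hc hU]

theorem IsWeakDeriv.sub_of_eq {f f' : ℝ → E} (hf : IsWeakDeriv U f g) (hf' : IsWeakDeriv U f' g)
    (hfi : LocallyIntegrableOn f U) (hfi' : LocallyIntegrableOn f' U) :
    IsWeakDeriv U (f - f') 0 := by
  intro φ hφ hc hU
  have hd : tsupport (deriv φ) ⊆ U := tsupport_deriv_subset.trans hU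
  have hdc : Continuous (deriv φ) := hφ.continuous_deriv (by simp)
  simp only [Pi.sub_apply, Pi.zero_apply, smul_zero, integral_zero, neg_zero, smul_sub]
  rw [integral_sub (integrable_smul_of_tsupport_subset hfi hdc hc.deriv hd).restrict
    (integrable_smul_of_tsupport_subset hfi' hdc hc.deriv hd).restrict, hf φ hφ hc hU,
    hf' φ hφ hc hU, sub_self]

theorem exists_deriv_eq_of_integral_eq_zero {θ : ℝ → ℝ} (hθ : ContDiff ℝ ∞ θ)
    (hsupp : Function.support θ ⊆ Icc a b) (hint : ∫ x, θ x = 0) :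
    ∃ φ : ℝ → ℝ, ContDiff ℝ ∞ φ ∧ Function.support φ ⊆ Icc a b ∧ deriv φ = θ := by
  have hIoo : Function.support θ ⊆ Ioo a b :=
    interior_Icc (a := a) (b := b) ▸ interior_maximal hsupp hθ.continuous.isOpen_support
  have hderiv (x : ℝ) : HasDerivAt (fun x => ∫ t in a..x, θ t) (θ x) x :=
    (hθ.continuous.integral_hasStrictDerivAt a x).hasDerivAt
  have hderiv_eq : deriv (fun x => ∫ t in a..x, θ t) = θ := funext fun x => (hderiv x).deriv
  refine ⟨_, contDiff_infty_iff_deriv.mpr ⟨fun x => (hderiv x).differentiableAt, ?_⟩,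
    fun x hx => ⟨?_, ?_⟩, hderiv_eq⟩
  · rwa [hderiv_eq]
  · by_contra! hxa
    refine hx (intervalIntegral.integral_zero_ae (ae_of_all _ fun t ht => ?_))
    rw [uIoc_of_ge hxa.le] at ht
    exact Function.notMem_support.mp fun h => ht.2.not_gt (hIoo h).1
  · by_contra! hbx
    exact hx ((intervalIntegral.integral_eq_integral_of_support_subset fun t ht =>
      ⟨(hIoo ht).1, (hIoo ht).2.le.trans hbx.le⟩).trans hint)

theorem exists_contDiff_integral_eq_one {V : Type*} [NormedAddCommGroup V] [NormedSpace ℝ V]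
    [HasContDiffBump V] [MeasurableSpace V] [BorelSpace V] [FiniteDimensional ℝ V]
    (μ : Measure V) [IsLocallyFiniteMeasure μ] [μ.IsOpenPosMeasure] {U : Set V} (hU : IsOpen U)
    (hne : U.Nonempty) :
    ∃ η : V → ℝ, ContDiff ℝ ∞ η ∧ HasCompactSupport η ∧ tsupport η ⊆ U ∧ ∫ x, η x ∂μ = 1 := by
  obtain ⟨c, hc⟩ := hne
  obtain ⟨r, hr, hrU⟩ := Metric.nhds_basis_closedBall.mem_iff.mp (hU.mem_nhds hc)
  let B : ContDiffBump c := ⟨r / 2, r, half_pos hr, half_lt_self hr⟩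
  exact ⟨B.normed μ, B.contDiff_normed, B.hasCompactSupport_normed,
    B.tsupport_normed_eq.trans_subset hrU, B.integral_normed⟩

theorem IsWeakDeriv.integral_smul_eq_zero {h : ℝ → E} (hw : IsWeakDeriv U h 0)
    (hU : U.OrdConnected) (hne : U.Nonempty) {θ : ℝ → ℝ} (hθ : ContDiff ℝ ∞ θ)
    (hc : HasCompactSupport θ) (hθU : tsupport θ ⊆ U) (hint : ∫ x, θ x = 0) :
    ∫ x, θ x • h x = 0 := by
  obtain ⟨a, b, hK, hab⟩ : ∃ a b, tsupport θ ⊆ Icc a b ∧ Icc a b ⊆ U := by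
    rcases (tsupport θ).eq_empty_or_nonempty with h0 | h0
    · obtain ⟨x, hx⟩ := hne
      exact ⟨x, x, by simp [h0], by simpa using hx⟩
    · exact ⟨_, _, hc.isBounded.subset_Icc_sInf_sSup,
        hU.out (hθU (hc.sInf_mem h0)) (hθU (hc.sSup_mem h0))⟩
  obtain ⟨φ, hφ, hφs, rfl⟩ :=
    exists_deriv_eq_of_integral_eq_zero hθ ((subset_tsupport θ).trans hK) hint
  have hφU : tsupport φ ⊆ U := (closure_minimal hφs isClosed_Icc).trans hab
  rw [← setIntegral_smul_of_tsupport_subset hθU,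
    hw φ hφ (.of_support_subset_isCompact isCompact_Icc hφs) hφU]
  simp

theorem IsWeakDeriv.exists_ae_eq_const [CompleteSpace E] {h : ℝ → E} (hw : IsWeakDeriv U h 0)
    (hU : IsOpen U) (hUc : U.OrdConnected) (hh : LocallyIntegrableOn h U) :
    ∃ c, ∀ᵐ x ∂volume.restrict U, h x = c := by
  rcases U.eq_empty_or_nonempty with rfl | hne
  · exact ⟨0, by simp⟩
  obtain ⟨η, hη, hηc, hηU, hη1⟩ := exists_contDiff_integral_eq_one volume hU hne
  refine ⟨∫ x, η x • h x, ?_⟩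
  rw [ae_restrict_iff' hU.measurableSet]
  suffices hzero : ∀ᵐ x, x ∈ U → h x - ∫ x, η x • h x = 0 by
    simpa only [sub_eq_zero] using hzero
  refine hU.ae_eq_zero_of_integral_contDiff_smul_eq_zero
    (hh.sub ((locallyIntegrable_const _).locallyIntegrableOn U)) fun ψ hψ hψc hψU => ?_
  have hψi : Integrable ψ := hψ.continuous.integrable_of_hasCompactSupport hψc
  have hηi : Integrable η := hη.continuous.integrable_of_hasCompactSupport hηc
  have hψh := integrable_smul_of_tsupport_subset hh hψ.continuous hψc hψU
  have hηh := integrable_smul_of_tsupport_subset hh hη.continuous hηc hηU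
  set m := ∫ x, ψ x
  -- `ψ - m * η` has mean zero, so it is the derivative of a test function.
  have horth : ∫ x, (ψ x - m * η x) • h x = 0 := by
    refine hw.integral_smul_eq_zero hUc hne (hψ.sub (contDiff_const.mul hη))
      (hψc.sub hηc.mul_left) ?_ ?_
    · exact (tsupport_sub _ _).trans (union_subset hψU (tsupport_mul_subset_right.trans hηU))
    · rw [integral_sub hψi (hηi.const_mul m), integral_const_mul, hη1, mul_one, sub_self]
  have hmηh : Integrable fun x => m • η x • h x := hηh.smul m
  simp only [sub_smul, mul_smul] at horth
  rw [integral_sub hψh hmηh, integral_smul] at horth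
  simp only [smul_sub]
  rwa [integral_sub hψh (hψi.smul_const _), integral_smul_const]

theorem MemW12.exists_isPrimitive [CompleteSpace E] (hU : IsOpen U) (hUc : U.OrdConnected)
    {f : ℝ → E} (hf : MemW12 U f) :
    ∃ F g : ℝ → E, IsPrimitive F g ∧ MemLp g 2 ∧ f =ᵐ[volume.restrict U] F := by
  obtain ⟨hf2, g₀, hg₀, hw⟩ := hf
  have hg : MemLp (U.indicator g₀) 2 := (memLp_indicator_iff_restrict hU.measurableSet).mpr hg₀
  have hF := isPrimitive_integral (hg.locallyIntegrable (by norm_num)) 0 0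
  have hFw : IsWeakDeriv U _ g₀ :=
    (hF.isWeakDeriv U).congr_ae .rfl (indicator_ae_eq_restrict hU.measurableSet)
  have hfi : LocallyIntegrableOn f U :=
    locallyIntegrableOn_of_locallyIntegrable_restrict (hf2.locallyIntegrable (by norm_num))
  have hFi : LocallyIntegrableOn _ U := hF.continuous.locallyIntegrable.locallyIntegrableOn U
  obtain ⟨c, hc⟩ := (hw.sub_of_eq hFw hfi hFi).exists_ae_eq_const hU hUc (hfi.sub hFi)
  refine ⟨_, _, isPrimitive_integral hF.locallyIntegrable c 0, hg, ?_⟩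
  filter_upwards [hc] with x hx
  rw [← hx, Pi.sub_apply, zero_add, sub_add_cancel]

theorem MemW12.congr_ae {f f' : ℝ → E} (hf : MemW12 U f) (hff' : f =ᵐ[volume.restrict U] f') :
    MemW12 U f' := by
  obtain ⟨hf2, g, hg, hw⟩ := hf
  exact ⟨(memLp_congr_ae hff').mp hf2, g, hg, hw.congr_ae hff' .rfl⟩

theorem MemW12.mono {V : Set ℝ} {f : ℝ → E} (hf : MemW12 V f) (hUV : U ⊆ V) : MemW12 U f := by
  obtain ⟨hf2, g, hg, hw⟩ := hf
  have hle : volume.restrict U ≤ volume.restrict V := Measure.restrict_mono hUV le_rfl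
  refine ⟨hf2.mono_measure hle, g, hg.mono_measure hle, fun φ hφ hc hU => ?_⟩
  have hd : tsupport (deriv φ) ⊆ U := tsupport_deriv_subset.trans hU
  rw [setIntegral_smul_of_tsupport_subset hd, setIntegral_smul_of_tsupport_subset hU,
    ← setIntegral_smul_of_tsupport_subset (hd.trans hUV),
    ← setIntegral_smul_of_tsupport_subset (hU.trans hUV), hw φ hφ hc (hU.trans hUV)]

theorem IsPrimitive.memW12_smul [CompleteSpace E] (hF : IsPrimitive F g) (hg : MemLp g 2)
    {χ : ℝ → ℝ} (hχ : ContDiff ℝ 1 χ) (hc : HasCompactSupport χ) (U : Set ℝ) :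
    MemW12 U fun x => χ x • F x := by
  have hχF : MemLp (fun x => χ x • F x) 2 :=
    (hχ.continuous.smul hF.continuous).memLp_of_hasCompactSupport hc.smul_right
  have hdF : MemLp (fun x => deriv χ x • F x) 2 :=
    ((hχ.continuous_deriv le_rfl).smul hF.continuous).memLp_of_hasCompactSupport
      hc.deriv.smul_right
  have hχg : MemLp (fun x => χ x • g x) 2 :=
    hg.smul (hχ.continuous.memLp_top_of_hasCompactSupport hc volume)
  exact ⟨hχF.restrict U, _, (hχg.add hdF).restrict U, (hF.smul hχ).isWeakDeriv U⟩

theorem IsPrimitive.ofReal_norm_sub_sq_div_le_lintegral (hF : IsPrimitive F g) (hab : a < b) :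
    ENNReal.ofReal (‖F b - F a‖ ^ 2 / (b - a)) ≤ ∫⁻ x in Ioo a b, ‖g x‖ₑ ^ 2 := by
  have hm : AEStronglyMeasurable g (volume.restrict (Ioo a b)) :=
    hF.locallyIntegrable.aestronglyMeasurable.restrict
  have hint : ‖F b - F a‖ₑ ≤ ∫⁻ x in Ioo a b, ‖g x‖ₑ * 1 := by
    rw [hF.sub_eq_integral, intervalIntegral.integral_of_le hab.le, integral_Ioc_eq_integral_Ioo]
    simpa only [mul_one] using enorm_integral_le_lintegral_enorm g
  have hholder : ∫⁻ x in Ioo a b, ‖g x‖ₑ * 1 ≤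
      (∫⁻ x in Ioo a b, ‖g x‖ₑ ^ (2 : ℝ)) ^ (1 / 2 : ℝ) * ENNReal.ofReal (b - a) ^ (1 / 2 : ℝ) := by
    simpa using ENNReal.lintegral_mul_le_Lp_mul_Lq (volume.restrict (Ioo a b))
      Real.HolderConjugate.two_two hm.enorm (g := fun _ => 1) aemeasurable_const
  rw [ENNReal.ofReal_div_of_pos (sub_pos.mpr hab), ENNReal.ofReal_pow (norm_nonneg _), ofReal_norm]
  refine ENNReal.div_le_of_le_mul ?_
  calc ‖F b - F a‖ₑ ^ 2
      ≤ _ := pow_le_pow_left' (hint.trans hholder) 2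
    _ = (∫⁻ x in Ioo a b, ‖g x‖ₑ ^ 2) * ENNReal.ofReal (b - a) := by
      rw [mul_pow, ← ENNReal.rpow_natCast, ← ENNReal.rpow_natCast, ← ENNReal.rpow_mul,
        ← ENNReal.rpow_mul]
      simp

end Primitive

section StrictValues

variable {X : Type*} [PseudoMetricSpace X] [MeasurableSpace X] {μ : Measure X} {x : X}

theorem eventually_measure_closedBall_ne_top [IsLocallyFiniteMeasure μ] :
    ∀ᶠ r in 𝓝[>] 0, μ (Metric.closedBall x r) ≠ ⊤ :=
  (tendsto_closedBall_smallSets x).eventually (μ.finiteAt_nhds x).eventually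
    |>.filter_mono nhdsWithin_le_nhds |>.mono fun _ => LT.lt.ne

variable [OpensMeasurableSpace X]

theorem eventually_ae_restrict_closedBall {p : X → Prop} (hp : ∀ᶠ z in 𝓝 x ⊓ ae μ, p z) :
    ∀ᶠ r : ℝ in 𝓝[>] 0, ∀ᵐ z ∂μ.restrict (Metric.closedBall x r), p z := by
  obtain ⟨s, hs, t, ht, hst⟩ := eventually_inf.mp hp
  obtain ⟨δ, hδ, hδs⟩ := Metric.nhds_basis_closedBall.mem_iff.mp hs
  filter_upwards [Ioc_mem_nhdsGT hδ] with r hr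
  filter_upwards [ae_restrict_of_ae ht, ae_restrict_mem measurableSet_closedBall] with z hzt hz
  exact hst z ⟨hδs (Metric.closedBall_subset_closedBall hr.2 hz), hzt⟩

theorem tendsto_setLAverage_closedBall [μ.IsOpenPosMeasure] [IsLocallyFiniteMeasure μ]
    {f : X → ℝ≥0∞} {c : ℝ≥0∞} (hf : Tendsto f (𝓝 x ⊓ ae μ) (𝓝 c)) :
    Tendsto (fun r => ⨍⁻ z in Metric.closedBall x r, f z ∂μ) (𝓝[>] 0) (𝓝 c) := by
  have hconst : ∀ᶠ r in 𝓝[>] 0, ∀ d, ⨍⁻ _ in Metric.closedBall x r, d ∂μ = d := by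
    filter_upwards [eventually_measure_closedBall_ne_top (μ := μ), self_mem_nhdsWithin]
      with r hr hr₀
    exact setLAverage_const (Metric.measure_closedBall_pos μ x hr₀).ne' hr
  refine tendsto_order.mpr ⟨fun d hd => ?_, fun d hd => ?_⟩
  · obtain ⟨d', hdd', hd'⟩ := exists_between hd
    filter_upwards [eventually_ae_restrict_closedBall (hf.eventually_const_le hd'), hconst]
      with r hr hr_const
    exact hdd'.trans_le ((hr_const d').ge.trans (laverage_mono_ae hr))
  · obtain ⟨d', hd', hdd'⟩ := exists_between hd
    filter_upwards [eventually_ae_restrict_closedBall (hf.eventually_le_const hd'), hconst]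
      with r hr hr_const
    exact (laverage_mono_ae hr).trans_lt ((hr_const d').trans_lt hdd')

variable {E : Type*} [NormedAddCommGroup E]

theorem tendsto_lintegral_closedBall_div {f : ℝ → ℝ≥0∞} {x : ℝ} {c : ℝ≥0∞}
    (hf : Tendsto f (𝓝 x ⊓ ae volume) (𝓝 c)) :
    Tendsto (fun r => (∫⁻ z in Metric.closedBall x r, f z) / ENNReal.ofReal r) (𝓝[>] 0)
      (𝓝 (2 * c)) := by
  refine (ENNReal.Tendsto.const_mul (tendsto_setLAverage_closedBall hf)
    (.inr (by simp))).congr fun r => ?_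
  rw [setLAverage_eq, Real.volume_closedBall, ENNReal.ofReal_mul two_pos.le, ENNReal.ofReal_ofNat,
    ← mul_div_assoc, ENNReal.mul_div_mul_left _ _ two_ne_zero (by simp)]

theorem IsStrictlyDefined.eq_of_tendsto {U : Set ℝ} {f : ℝ → E} {x : ℝ} {y : E}
    (hf : IsStrictlyDefined U f) (hx : x ∈ U) (hfy : Tendsto f (𝓝 x ⊓ ae volume) (𝓝 y)) :
    f x = y := by
  refine hf x hx y ?_
  simpa using tendsto_lintegral_closedBall_div (hfy.sub_const y).enorm

theorem isStrictlyDefined_of_continuous {f : ℝ → E} (hf : Continuous f) (U : Set ℝ) :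
    IsStrictlyDefined U f := by
  intro x _ y hy
  have hlim : Tendsto (fun z => ‖f z - y‖ₑ) (𝓝 x ⊓ ae volume) (𝓝 ‖f x - y‖ₑ) :=
    (hf.sub continuous_const).enorm.continuousAt.mono_left inf_le_left
  have hzero := tendsto_nhds_unique (tendsto_lintegral_closedBall_div hlim) hy
  simpa [sub_eq_zero] using hzero

end StrictValues

section Sorting

variable {Q : ℕ}

theorem monotone_sorted (s : Sym ℝ Q) : Monotone (sorted s) := fun _ _ hij =>
  (Multiset.pairwise_sort s.1 (· ≤ ·)).sortedLE.monotone_get ((Fin.cast_le_cast _).mpr hij)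

theorem sorted_ofTuple {p : Fin Q → ℝ} (hp : Monotone p) : sorted (ofTuple p) = p := by
  obtain ⟨π, hπ⟩ := exists_perm_of_ofTuple_eq (ofTuple_sorted (ofTuple p))
  have hsorted : sorted (ofTuple p) = p ∘ π := funext hπ
  have hmono : Monotone (p ∘ π) := hsorted ▸ monotone_sorted _
  exact hsorted.trans (Tuple.unique_monotone (τ := 1) hmono hp)

theorem monotone_ξ (s : Sym ℝ Q) : Monotone (ξ s) := monotone_sorted s

theorem ξ_ofTuple {p : EuclideanSpace ℝ (Fin Q)} (hp : Monotone p) : ξ (ofTuple p) = p := by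
  ext i
  exact congrFun (sorted_ofTuple hp) i

theorem ofTuple_ξ (s : Sym ℝ Q) : ofTuple (ξ s) = s := ofTuple_sorted s

theorem ξ_injective : Function.Injective (ξ : Sym ℝ Q → EuclideanSpace ℝ (Fin Q)) :=
  Function.LeftInverse.injective (g := fun p : EuclideanSpace ℝ (Fin Q) => ofTuple p) ofTuple_ξ

theorem isClosed_setOf_monotone {ι α : Type*} [Preorder ι] [Preorder α] [TopologicalSpace α]
    [OrderClosedTopology α] : IsClosed {p : ι → α | Monotone p} := by
  simp only [Monotone, ofPred_forall]
  exact isClosed_iInter fun i => isClosed_iInter fun j => isClosed_iInter fun _ =>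
    isClosed_le (continuous_apply i) (continuous_apply j)

theorem sum_abs_sub_sq_le_of_perm {ι : Type*} [Fintype ι] {p q : ι → ℝ} (hpq : Monovary p q)
    (σ : Equiv.Perm ι) : ∑ i, |p i - q i| ^ 2 ≤ ∑ i, |p i - q (σ i)| ^ 2 := by
  have hrearrange := hpq.sum_mul_comp_perm_le_sum_mul (σ := σ)
  have hσ : ∑ i, q (σ i) ^ 2 = ∑ i, q i ^ 2 := Equiv.sum_comp σ fun i => q i ^ 2
  simp only [sq_abs, sub_sq, Finset.sum_add_distrib, Finset.sum_sub_distrib, mul_assoc,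
    ← Finset.mul_sum, hσ]
  linarith

theorem dist𝒢_ofTuple_le_norm (p q : EuclideanSpace ℝ (Fin Q)) :
    dist𝒢 (ofTuple p) (ofTuple q) ≤ ‖p - q‖ := by
  rw [dist𝒢_ofTuple, EuclideanSpace.norm_eq]
  exact Finset.inf'_le _ (Finset.mem_univ 1)

theorem dist𝒢_eq_norm (s t : Sym ℝ Q) : dist𝒢 s t = ‖ξ s - ξ t‖ := by
  apply le_antisymm
  · simpa only [ofTuple_ξ] using dist𝒢_ofTuple_le_norm (ξ s) (ξ t)
  · refine Finset.le_inf' _ _ fun σ _ => ?_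
    rw [EuclideanSpace.norm_eq]
    exact Real.sqrt_le_sqrt
      (sum_abs_sub_sq_le_of_perm ((monotone_sorted s).monovary (monotone_sorted t)) σ)

end Sorting

section DensityFilter

open Asymptotics

variable {X : Type*} [PseudoMetricSpace X] [MeasurableSpace X]

/-- The filter of the sets whose complement has `μ`-density `0` at `a`, computed on closed balls.
Convergence along it is approximate convergence at `a`. -/
def densityFilter (μ : Measure X) (a : X) : Filter X :=
  Filter.comk
    (fun t => Tendsto (fun r => μ (Metric.closedBall a r ∩ t) / μ (Metric.closedBall a r))
      (𝓝[>] 0) (𝓝 0))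
    (by simp)
    (fun t ht s hst => tendsto_of_tendsto_of_tendsto_of_le_of_le tendsto_const_nhds ht
      (fun _ => zero_le) fun _ => by gcongr)
    (fun s hs t ht => by
      refine tendsto_of_tendsto_of_tendsto_of_le_of_le tendsto_const_nhds
        (by simpa only [add_zero] using hs.add ht) (fun _ => zero_le) fun r => ?_
      rw [inter_union_distrib_left, ← ENNReal.add_div]
      gcongr
      exact measure_union_le _ _)

variable {μ : Measure X} {a : X}

theorem mem_densityFilter_iff {s : Set X} : s ∈ densityFilter μ a ↔
    Tendsto (fun r => μ (Metric.closedBall a r ∩ sᶜ) / μ (Metric.closedBall a r))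
      (𝓝[>] 0) (𝓝 0) :=
  Filter.mem_comk

theorem densityFilter_le [OpensMeasurableSpace X] : densityFilter μ a ≤ 𝓝 a ⊓ ae μ := by
  intro s hs
  refine mem_densityFilter_iff.mpr (tendsto_const_nhds.congr' ?_)
  filter_upwards [eventually_ae_restrict_closedBall hs] with r hr
  have hnull : μ.restrict (Metric.closedBall a r) sᶜ = 0 := hr
  rw [inter_comm, ← Measure.restrict_apply' measurableSet_closedBall, hnull, ENNReal.zero_div]

instance densityFilter_neBot [μ.IsOpenPosMeasure] [IsLocallyFiniteMeasure μ] :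
    (densityFilter μ a).NeBot := by
  refine neBot_iff.mpr fun hbot => ?_
  have hempty := mem_densityFilter_iff.mp (empty_mem_iff_bot.mpr hbot)
  refine zero_ne_one (tendsto_nhds_unique hempty (tendsto_const_nhds.congr' ?_))
  filter_upwards [eventually_measure_closedBall_ne_top (μ := μ), self_mem_nhdsWithin] with r hr hr₀
  rw [compl_empty, inter_univ, ENNReal.div_self (Metric.measure_closedBall_pos μ a hr₀).ne' hr]

theorem densityFilter_le_nhdsNE [OpensMeasurableSpace X] [NullSingletonClass μ] :
    densityFilter μ a ≤ 𝓝[≠] a :=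
  densityFilter_le.trans <| inf_le_inf_left _ <|
    le_principal_iff.mpr (compl_mem_ae_iff.mpr (measure_singleton a))

theorem hasApLim_iff {f : ℝ → ℝ} {a l : ℝ} :
    HasApLim f a l ↔ Tendsto f (densityFilter volume a) (𝓝 l) := by
  rw [Metric.tendsto_nhds]
  refine forall₂_congr fun ε _ => ?_
  rw [Filter.Eventually, mem_densityFilter_iff]
  simp only [compl_ofPred, not_lt, Real.dist_eq]

theorem eq_zero_of_hasDerivAt_of_isLittleO {𝕜 E : Type*} [NontriviallyNormedField 𝕜]
    [NormedAddCommGroup E] [NormedSpace 𝕜 E] {f : 𝕜 → E} {f' : E} {a : 𝕜}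
    (hf : HasDerivAt f f' a) {l : Filter 𝕜} [l.NeBot] (hl : l ≤ 𝓝[≠] a)
    (hfo : f =o[l] fun x => x - a) : f' = 0 := by
  have hla : l ≤ 𝓝 a := hl.trans nhdsWithin_le_nhds
  have hfa : f a = 0 := tendsto_nhds_unique (hf.continuousAt.mono_left hla)
    (hfo.isBigO.trans_tendsto ((tendsto_sub_nhds_zero_iff.mpr tendsto_id).mono_left hla))
  refine tendsto_nhds_unique (hf.tendsto_slope.mono_left hl) ?_
  simpa only [slope_fun_def, vsub_eq_sub, hfa, sub_zero] using hfo.tendsto_inv_smul_nhds_zero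

end DensityFilter

section ApAffine

open Asymptotics

variable {Q : ℕ} {u : ℝ → Sym ℝ Q} {F : ℝ → EuclideanSpace ℝ (Fin Q)}
  {d : EuclideanSpace ℝ (Fin Q)} {a : ℝ}

theorem hasApAffine_iff {v : Fin Q → (ℝ →ᵃ[ℝ] ℝ)} : HasApAffine u a v ↔
    (fun x => dist𝒢 (u x) (ofTuple fun i => v i x)) =o[densityFilter volume a]
      fun x => x - a := by
  rw [HasApAffine, hasApLim_iff, ← isLittleO_abs_right, isLittleO_iff_tendsto']
  filter_upwards [densityFilter_le_nhdsNE self_mem_nhdsWithin] with x hx h0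
  exact absurd (sub_eq_zero.mp (abs_eq_zero.mp h0)) hx

theorem exists_perm_abs_sub_le_dist𝒢 (p q : Fin Q → ℝ) :
    ∃ σ : Equiv.Perm (Fin Q), ∀ i, |p i - q (σ i)| ≤ dist𝒢 (ofTuple p) (ofTuple q) := by
  obtain ⟨σ, -, hσ⟩ := Finset.exists_mem_eq_inf' Finset.univ_nonempty
    fun σ : Equiv.Perm (Fin Q) => √(∑ i, |p i - q (σ i)| ^ 2)
  refine ⟨σ, fun i => ?_⟩
  rw [dist𝒢_ofTuple, hσ]
  exact Real.le_sqrt_of_sq_le <| Finset.single_le_sum (f := fun i => |p i - q (σ i)| ^ 2)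
    (fun _ _ => by positivity) (Finset.mem_univ i)

theorem exists_frequently_eq {α β : Type*} [Finite β] {l : Filter α} [l.NeBot] (f : α → β) :
    ∃ b, ∃ᶠ x in l, f x = b := by
  by_contra! h
  obtain ⟨x, hx⟩ := (eventually_all.mpr h).exists
  exact hx (f x) rfl

theorem HasApAffine.exists_perm {v w : Fin Q → (ℝ →ᵃ[ℝ] ℝ)}
    (hv : HasApAffine u a v) (hw : HasApAffine u a w) :
    ∃ σ : Equiv.Perm (Fin Q), ∀ i, (v i).linear 1 = (w (σ i)).linear 1 := by
  have hvw : (fun x => dist𝒢 (ofTuple fun i => v i x) (ofTuple fun i => w i x))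
      =o[densityFilter volume a] fun x => x - a := by
    rw [hasApAffine_iff] at hv hw
    refine (IsBigO.of_bound' (.of_forall fun x => ?_)).trans_isLittleO
      (hv.norm_left.add hw.norm_left)
    simp only [dist𝒢_eq_norm, norm_norm]
    rw [Real.norm_of_nonneg (by positivity), norm_sub_rev (ξ (u x))]
    exact norm_sub_le_norm_sub_add_norm_sub _ _ _
  -- The optimal matching depends on `x`, but one of the finitely many matchings recurs near `a`.
  choose σ hσ using fun x => exists_perm_abs_sub_le_dist𝒢 (fun i => v i x) fun i => w i x
  obtain ⟨π, hπ⟩ := exists_frequently_eq (l := densityFilter volume a) σ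
  have := frequently_iff_neBot.mp hπ
  have hle : densityFilter volume a ⊓ 𝓟 {x | σ x = π} ≤ 𝓝[≠] a :=
    inf_le_left.trans densityFilter_le_nhdsNE
  refine ⟨π, fun i => sub_eq_zero.mp ?_⟩
  refine eq_zero_of_hasDerivAt_of_isLittleO ((v i).hasDerivAt.sub (w (π i)).hasDerivAt) hle
    (IsBigO.trans_isLittleO (IsBigO.of_bound' ?_) (hvw.mono inf_le_left))
  filter_upwards [mem_inf_of_right (mem_principal_self {x | σ x = π})] with x hx
  exact (hx ▸ hσ x i).trans (le_abs_self _)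

theorem exists_hasApAffine_of_hasDerivAt (hu : ∀ᶠ x in 𝓝 a ⊓ ae volume, ξ (u x) = F x)
    (hF : HasDerivAt F d a) :
    ∃ v, HasApAffine u a v ∧ ∀ i, (v i).linear 1 = d i := by
  refine ⟨fun i => .const ℝ ℝ (F a i) + d i • (.id ℝ ℝ - .const ℝ ℝ a), ?_, by simp⟩
  refine hasApAffine_iff.mpr (IsBigO.trans_isLittleO (IsBigO.of_bound' ?_)
    (hF.isLittleO.mono (densityFilter_le.trans inf_le_left)))
  filter_upwards [densityFilter_le hu] with x hx
  have hle := dist𝒢_ofTuple_le_norm (ξ (u x)) (F a + (x - a) • d)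
  rw [ofTuple_ξ, hx, ← sub_sub] at hle
  rw [Real.norm_of_nonneg (dist𝒢_eq_norm _ _ ▸ norm_nonneg _)]
  simpa [mul_comm, Pi.add_def] using hle

theorem apNormSq_eq_of_hasDerivAt (hu : ∀ᶠ x in 𝓝 a ⊓ ae volume, ξ (u x) = F x)
    (hF : HasDerivAt F d a) : apNormSq u a = ‖d‖ₑ ^ 2 := by
  obtain ⟨v, hv, hvd⟩ := exists_hasApAffine_of_hasDerivAt hu hF
  have hex : ∃ v, HasApAffine u a v := ⟨v, hv⟩
  obtain ⟨σ, hσ⟩ := hex.choose_spec.exists_perm hv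
  rw [apNormSq, dif_pos hex, ← ofReal_norm, ← ENNReal.ofReal_pow (norm_nonneg _),
    EuclideanSpace.norm_sq_eq, ← Equiv.sum_comp σ fun i => ‖d i‖ ^ 2]
  simp only [hσ, hvd, Real.norm_eq_abs]

theorem Dir_eq_lintegral {g : ℝ → EuclideanSpace ℝ (Fin Q)} (hF : IsPrimitive F g) {U : Set ℝ}
    (hU : IsOpen U) (hae : ∀ᵐ x ∂volume.restrict U, ξ (u x) = F x) :
    Dir u U = ∫⁻ x in U, ‖g x‖ₑ ^ 2 := by
  refine lintegral_congr_ae ?_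
  filter_upwards [ae_restrict_of_ae hF.ae_hasDerivAt, ae_restrict_mem hU.measurableSet]
    with x hx hxU
  refine apNormSq_eq_of_hasDerivAt (eventually_inf.mpr ⟨U, hU.mem_nhds hxU, _,
    (ae_restrict_iff' hU.measurableSet).mp hae, fun y hy => hy.2 hy.1⟩) hx

end ApAffine

section BoundaryValues

variable {Q : ℕ} {U : Set ℝ} {a b : ℝ} {u w h : ℝ → Sym ℝ Q} {F g : ℝ → EuclideanSpace ℝ (Fin Q)}

/-- `w` is a continuous representative on all of `ℝ` of the map `u` on `U`: it agrees with `u`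
almost everywhere on `U`, and `ξ ∘ w` is a primitive of the square integrable function `g`. -/
structure IsRepresentative (U : Set ℝ) (u w : ℝ → Sym ℝ Q) (g : ℝ → EuclideanSpace ℝ (Fin Q)) :
    Prop where
  isPrimitive : IsPrimitive (fun x => ξ (w x)) g
  memLp : MemLp g 2
  ae_eq : u =ᵐ[volume.restrict U] w

theorem closure_subset_of_ae_mem {X : Type*} [TopologicalSpace X] [MeasurableSpace X]
    [OpensMeasurableSpace X] {μ : Measure X} [μ.IsOpenPosMeasure] {U S : Set X} (hU : IsOpen U)
    (hS : IsClosed S) (h : ∀ᵐ x ∂μ.restrict U, x ∈ S) : closure U ⊆ S := by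
  have hdense : Dense {x | x ∈ U → x ∈ S} :=
    Measure.dense_of_ae ((ae_restrict_iff' hU.measurableSet).mp h)
  exact closure_minimal ((hdense.open_subset_closure_inter hU).trans
    (closure_minimal (fun x hx => hx.2 hx.1) hS)) hS

theorem isRepresentative_clamp (hab : a ≤ b) (hF : IsPrimitive F g)
    (hg : MemLp g 2 (volume.restrict (Ioc a b))) (hmono : ∀ x ∈ Icc a b, Monotone (F x)) :
    IsRepresentative (Icc a b) (fun x => ofTuple (F x))
      (fun x => ofTuple (F (max a (min b x)))) ((Ioc a b).indicator g) := by
  refine ⟨?_, (memLp_indicator_iff_restrict measurableSet_Ioc).mpr hg, ?_⟩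
  · convert hF.clamp hab using 2 with x
    exact ξ_ofTuple (hmono _ ⟨le_max_left _ _, max_le hab (min_le_left _ _)⟩)
  · filter_upwards [ae_restrict_mem measurableSet_Icc] with x hx
    rw [min_eq_right hx.2, max_eq_right hx.1]

theorem MemY2.exists_isRepresentative (hab : a < b) (hu : MemY2 (Ioo a b) u) :
    ∃ w g, IsRepresentative (Ioo a b) u w g := by
  obtain ⟨F, g, hF, hg, hae⟩ := MemW12.exists_isPrimitive isOpen_Ioo ordConnected_Ioo hu
  have hmono : Icc a b ⊆ {x | Monotone (F x)} := by
    rw [← closure_Ioo hab.ne]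
    refine closure_subset_of_ae_mem (μ := volume) isOpen_Ioo
      (isClosed_setOf_monotone.preimage ((PiLp.continuous_ofLp 2 _).comp hF.continuous)) ?_
    filter_upwards [hae] with x hx
    exact hx ▸ monotone_ξ (u x)
  -- Outside `Icc a b` the vectors `F x` need not be nondecreasing, so `F` is frozen there.
  have hclamp := isRepresentative_clamp hab.le hF (hg.restrict _) hmono
  refine ⟨_, _, hclamp.isPrimitive, hclamp.memLp, ?_⟩
  filter_upwards [hae, ae_restrict_of_ae_restrict_of_subset Ioo_subset_Icc_self hclamp.ae_eq]
    with x hx hx_clamp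
  rw [← hx_clamp, ← hx, ofTuple_ξ]

namespace IsRepresentative

theorem mono {V : Set ℝ} (hw : IsRepresentative V u w g) (hUV : U ⊆ V) :
    IsRepresentative U u w g :=
  ⟨hw.isPrimitive, hw.memLp, ae_restrict_of_ae_restrict_of_subset hUV hw.ae_eq⟩

theorem eqOn (hw : IsRepresentative U u w g) (hU : IsOpen U) (hu : StrictlyDefined U u) :
    EqOn u w U := by
  intro x hx
  refine ξ_injective (IsStrictlyDefined.eq_of_tendsto hu hx ?_)
  refine (hw.isPrimitive.continuous.continuousAt.mono_left inf_le_left).congr' ?_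
  refine eventually_inf.mpr ⟨U, hU.mem_nhds hx, _,
    (ae_restrict_iff' hU.measurableSet).mp hw.ae_eq, fun y hy => ?_⟩
  exact congrArg ξ (hy.2 hy.1).symm

theorem eqOn_Icc {w' : ℝ → Sym ℝ Q} {g' : ℝ → EuclideanSpace ℝ (Fin Q)} (hab : a ≠ b)
    (hw : IsRepresentative (Ioo a b) u w g) (hw' : IsRepresentative (Ioo a b) u w' g') :
    EqOn w w' (Icc a b) := by
  have hξ : EqOn (fun x => ξ (w x)) (fun x => ξ (w' x)) (Icc a b) := by
    refine Measure.eqOn_Icc_of_ae_eq volume hab ?_ hw.isPrimitive.continuous.continuousOn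
      hw'.isPrimitive.continuous.continuousOn
    rw [← restrict_Ioo_eq_restrict_Icc]
    filter_upwards [hw.ae_eq, hw'.ae_eq] with x hx hx'
    rw [← hx, ← hx']
  exact fun x hx => ξ_injective (hξ hx)

theorem Dir_eq (hw : IsRepresentative U u w g) (hU : IsOpen U) :
    Dir u U = ∫⁻ x in U, ‖g x‖ₑ ^ 2 :=
  Dir_eq_lintegral hw.isPrimitive hU (hw.ae_eq.fun_comp ξ)

theorem le_Dir (hw : IsRepresentative (Ioo a b) u w g) (hab : a < b) :
    ENNReal.ofReal (dist𝒢 (w b) (w a) ^ 2 / (b - a)) ≤ Dir u (Ioo a b) := by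
  rw [dist𝒢_eq_norm, hw.Dir_eq isOpen_Ioo]
  exact hw.isPrimitive.ofReal_norm_sub_sq_div_le_lintegral hab

theorem exists_extension (hw : IsRepresentative U u w g) (hab : a < b) :
    ∃ w', MemY2 univ w' ∧ StrictlyDefined univ w' ∧ EqOn w' w (Icc a b) := by
  let χ : ContDiffBump ((a + b) / 2) := ⟨(b - a) / 2, b - a, by linarith, by linarith⟩
  let w' : ℝ → Sym ℝ Q := fun x => ofTuple (χ x • ξ (w x) : EuclideanSpace ℝ (Fin Q))
  have hw' : (fun x => ξ (w' x)) = fun x => χ x • ξ (w x) :=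
    funext fun x => ξ_ofTuple ((monotone_ξ (w x)).const_mul χ.nonneg)
  refine ⟨w', ?_, ?_, fun x hx => ?_⟩
  · rw [MemY2, hw']
    exact hw.isPrimitive.memW12_smul hw.memLp χ.contDiff χ.hasCompactSupport univ
  · rw [StrictlyDefined, hw']
    exact isStrictlyDefined_of_continuous (χ.continuous.smul hw.isPrimitive.continuous) univ
  · change ofTuple (χ x • ξ (w x) : EuclideanSpace ℝ (Fin Q)) = w x
    rw [Real.Icc_eq_closedBall] at hx
    rw [χ.one_of_mem_closedBall hx, one_smul, ofTuple_ξ]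

theorem hasBoundaryValues_iff (hw : IsRepresentative (Ioo a b) u w g) (hab : a < b) :
    HasBoundaryValues (Ioo a b) u h ↔ h a = w a ∧ h b = w b := by
  have ha := left_mem_Icc.mpr hab.le
  have hb := right_mem_Icc.mpr hab.le
  constructor
  · rintro ⟨w₁, hw₁, hs₁, hw₁u, hw₁h⟩
    have hsub : Icc a b ⊆ Ioo (a - 1) (b + 1) := Icc_subset_Ioo (by simp) (by simp)
    obtain ⟨w₂, g₂, hw₂⟩ := MemY2.exists_isRepresentative (a := a - 1) (b := b + 1)
      (by linarith) (MemW12.mono hw₁ (subset_univ _))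
    have hw₁₂ := (hw₂.eqOn isOpen_Ioo fun x _ => hs₁ x (mem_univ x)).mono hsub
    have hw₂u : IsRepresentative (Ioo a b) u w₂ g₂ :=
      ⟨hw₂.isPrimitive, hw₂.memLp, EventuallyEq.trans (EventuallyEq.symm hw₁u)
        (hw₂.mono (Ioo_subset_Icc_self.trans hsub)).ae_eq⟩
    have heq : EqOn w₁ w (Icc a b) := hw₁₂.trans (hw₂u.eqOn_Icc hab.ne hw)
    rw [frontier_Ioo hab] at hw₁h
    exact ⟨(hw₁h a (by simp)).symm.trans (heq ha), (hw₁h b (by simp)).symm.trans (heq hb)⟩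
  · rintro ⟨hha, hhb⟩
    obtain ⟨w', hw', hs', heq⟩ := hw.exists_extension hab
    refine ⟨w', hw', hs', ?_, ?_⟩
    · filter_upwards [hw.ae_eq, ae_restrict_mem measurableSet_Ioo] with x hx hxU
      rw [heq (Ioo_subset_Icc_self hxU), hx]
    · rw [frontier_Ioo hab]
      rintro x (rfl | rfl)
      exacts [(heq ha).trans hha.symm, (heq hb).trans hhb.symm]

theorem Dir_le_of_forall_Ioo {K : ℝ} (hw : IsRepresentative (Ioo a b) u w g) (hab : a < b)
    (hK : ∀ x y, a < x → x < y → y < b →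
      Dir u (Ioo x y) ≤ ENNReal.ofReal (K * (dist𝒢 (w y) (w x) ^ 2 / (y - x)))) :
    Dir u (Ioo a b) ≤ ENNReal.ofReal (K * (dist𝒢 (w b) (w a) ^ 2 / (b - a))) := by
  have ha : Tendsto (fun t : ℝ => a + t) (𝓝[>] 0) (𝓝 a) :=
    (Continuous.tendsto' (by fun_prop) _ _ (add_zero a)).mono_left nhdsWithin_le_nhds
  have hb : Tendsto (fun t : ℝ => b - t) (𝓝[>] 0) (𝓝 b) :=
    (Continuous.tendsto' (by fun_prop) _ _ (sub_zero b)).mono_left nhdsWithin_le_nhds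
  have hDir := (aecover_Ioo_of_Ioo (μ := volume) ha hb).lintegral_tendsto_of_countably_generated
    (hw.memLp.1.enorm.pow_const 2).restrict
  have hwa := (hw.isPrimitive.continuous.tendsto a).comp ha
  have hwb := (hw.isPrimitive.continuous.tendsto b).comp hb
  simp_rw [hw.Dir_eq isOpen_Ioo, dist𝒢_eq_norm]
  refine le_of_tendsto_of_tendsto hDir (ENNReal.tendsto_ofReal
    ((((hwb.sub hwa).norm.pow 2).div (hb.sub ha) (sub_pos.mpr hab).ne').const_mul K)) ?_
  filter_upwards [Ioo_mem_nhdsGT (half_pos (sub_pos.mpr hab))] with t ht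
  have hsub : Ioo (a + t) (b - t) ⊆ Ioo a b :=
    Ioo_subset_Ioo (by linarith [ht.1]) (by linarith [ht.1])
  rw [Measure.restrict_restrict measurableSet_Ioo, inter_eq_left.mpr hsub,
    ← (hw.mono hsub).Dir_eq isOpen_Ioo]
  change _ ≤ ENNReal.ofReal (K * (‖ξ (w (b - t)) - ξ (w (a + t))‖ ^ 2 / (b - t - (a + t))))
  rw [← dist𝒢_eq_norm]
  exact hK (a + t) (b - t) (by linarith [ht.1]) (by linarith [ht.2]) (by linarith [ht.1])

end IsRepresentative

theorem HasBoundaryValues.memY2 (hu : HasBoundaryValues U u h) : MemY2 U u := by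
  obtain ⟨w, hw, -, hwu, -⟩ := hu
  exact (MemW12.mono hw (subset_univ U)).congr_ae (EventuallyEq.fun_comp hwu ξ)

theorem HasBoundaryValues.le_Dir (hu : HasBoundaryValues (Ioo a b) u h) (hab : a < b) :
    ENNReal.ofReal (dist𝒢 (h b) (h a) ^ 2 / (b - a)) ≤ Dir u (Ioo a b) := by
  obtain ⟨w, g, hw⟩ := hu.memY2.exists_isRepresentative hab
  obtain ⟨ha, hb⟩ := (hw.hasBoundaryValues_iff hab).mp hu
  rw [ha, hb]
  exact hw.le_Dir hab

theorem isPrimitive_lineMap {E : Type*} [NormedAddCommGroup E] [NormedSpace ℝ E] [CompleteSpace E]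
    (p q : E) (a b : ℝ) :
    IsPrimitive (fun x => AffineMap.lineMap p q ((x - a) / (b - a)))
      fun _ => (b - a)⁻¹ • (q - p) := by
  refine ⟨locallyIntegrable_const _, fun x y => ?_⟩
  rw [intervalIntegral.integral_const]
  simp only [AffineMap.lineMap_apply_module']
  module

theorem monotone_lineMap {p q : EuclideanSpace ℝ (Fin Q)} (hp : Monotone p) (hq : Monotone q)
    {t : ℝ} (ht : t ∈ Icc 0 1) : Monotone (AffineMap.lineMap p q t : EuclideanSpace ℝ (Fin Q)) := by
  rw [AffineMap.lineMap_apply_module]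
  exact (hp.const_mul (sub_nonneg.mpr ht.2)).add (hq.const_mul ht.1)

theorem exists_isDirMinimizing (hab : a < b) (h : ℝ → Sym ℝ Q) :
    ∃ v, IsDirMinimizing (Ioo a b) h v ∧
      Dir v (Ioo a b) = ENNReal.ofReal (dist𝒢 (h b) (h a) ^ 2 / (b - a)) := by
  have hba : 0 < b - a := sub_pos.mpr hab
  let L (x : ℝ) : EuclideanSpace ℝ (Fin Q) :=
    AffineMap.lineMap (ξ (h a)) (ξ (h b)) ((x - a) / (b - a))
  have hL : IsPrimitive L fun _ => (b - a)⁻¹ • (ξ (h b) - ξ (h a)) :=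
    isPrimitive_lineMap (ξ (h a)) (ξ (h b)) a b
  have hmono (x : ℝ) (hx : x ∈ Icc a b) : Monotone (L x) :=
    monotone_lineMap (monotone_ξ _) (monotone_ξ _) ⟨div_nonneg (sub_nonneg.mpr hx.1) hba.le,
      div_le_one_of_le₀ (sub_le_sub_right hx.2 a) hba.le⟩
  let v (x : ℝ) : Sym ℝ Q := ofTuple (L x)
  have hbv : HasBoundaryValues (Ioo a b) v h := by
    have hv := isRepresentative_clamp hab.le hL (memLp_const _) hmono
    refine ((hv.mono Ioo_subset_Icc_self).hasBoundaryValues_iff hab).mpr ?_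
    simp [L, hab.le, hba.ne', ofTuple_ξ]
  have hDir : Dir v (Ioo a b) = ENNReal.ofReal (dist𝒢 (h b) (h a) ^ 2 / (b - a)) := by
    rw [Dir_eq_lintegral hL isOpen_Ioo ((ae_restrict_mem measurableSet_Ioo).mono fun x hx =>
        ξ_ofTuple (hmono x (Ioo_subset_Icc_self hx))),
      setLIntegral_const, Real.volume_Ioo, dist𝒢_eq_norm,
      ← ofReal_norm, ← ENNReal.ofReal_pow (norm_nonneg _), ← ENNReal.ofReal_mul (by positivity)]
    congr 1
    rw [norm_smul, norm_inv, Real.norm_eq_abs, abs_of_pos hba]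
    field_simp
  refine ⟨v, ⟨hbv.memY2, hbv, le_antisymm (le_sInf ?_) (sInf_le ⟨v, hbv.memY2, hbv, rfl⟩)⟩, hDir⟩
  rintro _ ⟨v', -, hv', rfl⟩
  exact hDir.trans_le (hv'.le_Dir hab)

end BoundaryValues

end MultiValued

end

open MultiValued in
theorem mainTheorem7_general (Q : ℕ) (K : ℝ) (hK : 0 ≤ K) (u : ℝ → Sym ℝ Q)
    (hu : MemY2 (Ioo (-1) 1) u) (hs : StrictlyDefined (Ioo (-1) 1) u) :
    List.TFAE [
      IsQuasiminimizer K u,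
      ∀ a b : ℝ, -1 < a → a < b → b < 1 →
        Dir u (Ioo a b) ≤ ENNReal.ofReal (K * (dist𝒢 (u b) (u a) ^ 2 / (b - a))),
      ∀ a b : ℝ, -1 ≤ a → a < b → b ≤ 1 →
        ∃ g : ℝ → Sym ℝ Q, HasBoundaryValues (Ioo a b) u g ∧
          Dir u (Ioo a b) ≤ ENNReal.ofReal (K * (dist𝒢 (g b) (g a) ^ 2 / (b - a)))] := by
  obtain ⟨w, g, hw⟩ := hu.exists_isRepresentative (by norm_num)
  have huw : EqOn u w (Ioo (-1) 1) := hw.eqOn isOpen_Ioo hs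
  have hsub {a b : ℝ} (ha : -1 ≤ a) (hb : b ≤ 1) : IsRepresentative (Ioo a b) u w g :=
    hw.mono (Ioo_subset_Ioo ha hb)
  tfae_have 1 → 2 := by
    rintro ⟨-, -, hmin⟩ a b ha hab hb
    obtain ⟨v, hv, hDir⟩ := exists_isDirMinimizing hab u
    rw [ENNReal.ofReal_mul hK, ← hDir]
    exact hmin a b ha.le hab hb.le u v (((hsub ha.le hb.le).hasBoundaryValues_iff hab).mpr
      ⟨huw ⟨ha, hab.trans hb⟩, huw ⟨ha.trans hab, hb⟩⟩) hv
  tfae_have 2 → 3 := by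
    refine fun h a b ha hab hb => ⟨w, ((hsub ha hb).hasBoundaryValues_iff hab).mpr ⟨rfl, rfl⟩,
      (hsub ha hb).Dir_le_of_forall_Ioo hab fun x y hx hxy hy => ?_⟩
    rw [← huw ⟨ha.trans_lt hx, by linarith⟩, ← huw ⟨by linarith, hy.trans_le hb⟩]
    exact h x y (ha.trans_lt hx) hxy (hy.trans_le hb)
  tfae_have 3 → 1 := by
    refine fun h => ⟨hu, hs, fun a b ha hab hb k v huk hv => ?_⟩
    obtain ⟨g, hug, hDir⟩ := h a b ha hab hb
    obtain ⟨hka, hkb⟩ := ((hsub ha hb).hasBoundaryValues_iff hab).mp huk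
    obtain ⟨hga, hgb⟩ := ((hsub ha hb).hasBoundaryValues_iff hab).mp hug
    rw [hga, hgb, ← hka, ← hkb, ENNReal.ofReal_mul hK] at hDir
    exact hDir.trans (mul_le_mul_right (hv.2.1.le_Dir hab) _)
  tfae_finish

open MultiValued in
theorem mainTheorem7 (Q : ℕ) (hQ : 0 < Q) (K : ℝ) (hK : 1 < K) (u : ℝ → Sym ℝ Q)
    (hu : MemY2 (Ioo (-1) 1) u) (hs : StrictlyDefined (Ioo (-1) 1) u) :
    List.TFAE [
      IsQuasiminimizer K u,
      ∀ a b : ℝ, -1 < a → a < b → b < 1 →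
        Dir u (Ioo a b) ≤ ENNReal.ofReal (K * (dist𝒢 (u b) (u a) ^ 2 / (b - a))),
      ∀ a b : ℝ, -1 ≤ a → a < b → b ≤ 1 →
        ∃ g : ℝ → Sym ℝ Q, HasBoundaryValues (Ioo a b) u g ∧
          Dir u (Ioo a b) ≤ ENNReal.ofReal (K * (dist𝒢 (g b) (g a) ^ 2 / (b - a)))] := by
  exact mainTheorem7_general Q K (by linarith) u hu hs
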